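/- Let $\mathscr A$ be a unital $C^*$-algebra, let $\mathscr G$ be its group of invertible elements (a real Banach–Lie group, open in $\mathscr A$), and let $\mathscr S$ be the set of states of $\mathscr A$, i.e. of positive continuous linear functionals $\rho$ with $\rho(\mathbb I)=1$. The group $\mathscr G$ acts on $\mathscr S$ from the left by $$(\Phi_{g}\rho)(a)=\frac{\rho(g^\dagger a g)}{\rho(g^\dagger g)},\qquad g\in\mathscr G,\ \rho\in\mathscr S,\ a\in\mathscr A .$$ An orbit $\mathcal O$ of a Banach–Lie group $G$ through a point $s$ of a set is called a smooth homogeneous Banach manifold of $G$ if the isotropy group $G_s$ is a Banach–Lie subgroup of $G$ (a subgroup which is a split Banach submanifold), so that $G/G_s$ is a smooth Banach manifold with $G\to G/G_s$ a smooth submersion and smooth left $G$-action, and $\mathcal O$ carries a smooth Banach manifold structure for which the canonical bijection $G/G_s\to\mathcal O$ is a diffeomorphism, the orbit map $g\mapsto g\cdot s$ is a smooth surjective submersion and the transitive action of $G$ on $\mathcal O$ is smooth. (1) Let $\tau$ be a faithful tracial state of $\mathscr A$ ($\tau(a^\dagger a)>0$ for $a\neq 0$, $\tau(ab)=\tau(ba)$),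 and let $\mathcal O^\tau$ be the $\Phi$-orbit of $\mathscr G$ through $\tau$. Then $\mathcal O^\tau$ is a smooth homogeneous Banach manifold of $\mathscr G$. The set $\{gg^\dagger/\tau(gg^\dagger) : g\in\mathscr G\}$ is exactly the set of positive invertible elements $x\in\mathscr A$ with $\tau(x)=1$, and there is a bijection from $\mathcal O^\tau$ onto this set which sends $\Phi_g\tau$ to $gg^\dagger/\tau(gg^\dagger)$ for every $g\in\mathscr G$; if $x$ corresponds to $\rho\in\mathcal O^\tau$, then $\rho(a)=\tau(xa)$ for all $a\in\mathscr A$. If $\mathscr A$ is finite-dimensional, then $\mathcal O^\tau$ is the set of all faithful states of $\mathscr A$. (2) If $\mathscr A=\mathbb C^n$ and $\tau$ is a faithful state, then $p\mapsto\big(a\mapsto\sum_i p_ia_i\big)$ is a bijection from the open simplex $\{p\in\mathbb R^n: p_i>0 \text{ for all } i,\ \sum_ip_i=1\}$ onto $\mathcal O^\tau$. (3) Let $(\mathcal X,\Sigma,\nu)$ be a probability space and $\mathscr A=L^\infty(\mathcal X,\nu)$ (complex-valued). Then $f\mapsto\int f\,d\nu$ is a faithful tracial state of $\mathscr A$, and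 its $\Phi$-orbit $\mathcal O^\nu$ is a smooth homogeneous Banach manifold of $\mathscr G$. Let $$\mathscr M_\nu=\Big\{f\in L^\infty(\mathcal X,\nu): f\ge c\ \ \nu\text{-a.e. for some constant } c>0,\ \int_{\mathcal X} f\,d\nu=1\Big\}$$ be the set of probability densities that are strictly positive (positive and invertible) elements of $L^\infty(\mathcal X,\nu)$. Then sending $f$ to the state $h\mapsto\int fh\,d\nu$ defines a bijection of $\mathscr M_\nu$ onto $\mathcal O^\nu$, under which $\Phi_g$ becomes $f\mapsto |g|^2f\big/\int|g|^2f\,d\nu$. Equivalently, $\mathcal O^\nu$ consists exactly of the states $h\mapsto\int h\,d\mu$, where $\mu$ is a probability measure mutually absolutely continuous with $\nu$ whose density satisfies $c\le d\mu/d\nu\le C$ $\nu$-a.e. for some constants $0<c\le C<\infty$. -/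

import Mathlib

open scoped ContDiff Manifold ComplexOrder
open MeasureTheory

universe u v

/-! ### Banach-Lie subgroups and homogeneous Banach manifolds -/

/-- A subgroup `K` of a (real, smooth) Banach-Lie group `G` modelled on `E` is a Banach-Lie
subgroup if it is a split Banach submanifold of `G`: around each of its points there is a smooth
chart of `G` in which `K` becomes a closed complemented linear subspace of `E`. -/
def IsBanachLieSubgroup (E : Type*) [NormedAddCommGroup E] [NormedSpace ℝ E]
    {G : Type*} [TopologicalSpace G] [ChartedSpace E G] [Group G] (K : Subgroup G) : Prop :=
  ∀ x ∈ K, ∃ e ∈ IsManifold.maximalAtlas 𝓘(ℝ, E) ∞ G, x ∈ e.source ∧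
    ∃ F : Submodule ℝ E, F.ClosedComplemented ∧ ∀ y ∈ e.source, y ∈ K ↔ e y ∈ F

/-- The given charts on the coset space `G ⧸ K` (with its quotient topology) make it a Hausdorff
smooth Banach manifold such that the projection of `G` is a smooth submersion and left translation
is a smooth action. This determines the smooth structure of `G ⧸ K`. -/
structure IsQuotientManifold (E F : Type*) [NormedAddCommGroup E] [NormedSpace ℝ E]
    [NormedAddCommGroup F] [NormedSpace ℝ F]
    {G : Type*} [TopologicalSpace G] [ChartedSpace E G] [Group G] (K : Subgroup G)
    [ChartedSpace F (G ⧸ K)] : Prop where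
  isManifold : IsManifold 𝓘(ℝ, F) ∞ (G ⧸ K)
  t2 : T2Space (G ⧸ K)
  isSubmersion :
    Manifold.IsSubmersion 𝓘(ℝ, E) 𝓘(ℝ, F) ∞ (fun g : G => (QuotientGroup.mk g : G ⧸ K))
  contMDiff_smul : ContMDiff (𝓘(ℝ, E).prod 𝓘(ℝ, F)) 𝓘(ℝ, F) ∞
    (fun p : G × (G ⧸ K) => p.1 • p.2)

/-- Let the Banach-Lie group `G` (modelled on `E`) act on the set `S`. The orbit of `s` is a smooth
homogeneous Banach manifold of `G` if the isotropy subgroup `G_s` is a Banach-Lie subgroup of `G`,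
so that `G ⧸ G_s` is a smooth Banach manifold, and the orbit carries a structure of a smooth Banach
manifold for which the canonical bijection `[g] ↦ g • s` of `G ⧸ G_s` with the orbit is a
diffeomorphism, the orbit map `g ↦ g • s` is a smooth (surjective) submersion and the (transitive)
action of `G` on the orbit is smooth. -/
def IsHomogeneousBanachManifoldOrbit (E : Type u) [NormedAddCommGroup E] [NormedSpace ℝ E]
    (G : Type u) [TopologicalSpace G] [ChartedSpace E G] [Group G]
    {S : Type u} [MulAction G S] (s : S) : Prop :=
  IsBanachLieSubgroup E (MulAction.stabilizer G s) ∧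
  ∃ (F : Type u) (_ : NormedAddCommGroup F) (_ : NormedSpace ℝ F) (_ : CompleteSpace F)
    (_ : ChartedSpace F (G ⧸ MulAction.stabilizer G s))
    (_ : TopologicalSpace (MulAction.orbit G s)) (_ : ChartedSpace F (MulAction.orbit G s)),
    IsQuotientManifold E F (MulAction.stabilizer G s) ∧
    T2Space (MulAction.orbit G s) ∧
    IsManifold 𝓘(ℝ, F) ∞ (MulAction.orbit G s) ∧
    ContMDiff 𝓘(ℝ, F) 𝓘(ℝ, F) ∞ (MulAction.orbitEquivQuotientStabilizer G s) ∧
    ContMDiff 𝓘(ℝ, F) 𝓘(ℝ, F) ∞ (MulAction.orbitEquivQuotientStabilizer G s).symm ∧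
    Manifold.IsSubmersion 𝓘(ℝ, E) 𝓘(ℝ, F) ∞
      (fun g : G => (⟨g • s, MulAction.mem_orbit s g⟩ : MulAction.orbit G s)) ∧
    ContMDiff (𝓘(ℝ, E).prod 𝓘(ℝ, F)) 𝓘(ℝ, F) ∞
      (fun p : G × MulAction.orbit G s => p.1 • p.2)

/-! ### States and the state-preserving action of the invertible elements -/

/-- A state of a unital C*-algebra: a positive continuous linear functional normalized by
`ρ 1 = 1` (for a positive functional, `‖ρ‖ = ρ 1`). -/
@[ext]
structure CStarState (A : Type*) [CStarAlgebra A] where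
  toCLM : A →L[ℂ] ℂ
  nonneg : ∀ a, 0 ≤ toCLM (star a * a)
  map_one : toCLM 1 = 1

namespace CStarState

noncomputable instance {A : Type*} [CStarAlgebra A] : CoeFun (CStarState A) (fun _ => A → ℂ) :=
  ⟨fun ρ => ρ.toCLM⟩

variable {A : Type*} [CStarAlgebra A]

/-- A state is faithful if it is strictly positive on nonzero positive elements. -/
def IsFaithful (ρ : CStarState A) : Prop := ∀ a : A, a ≠ 0 → 0 < ρ (star a * a)

/-- A state is tracial if `ρ (a b) = ρ (b a)`. -/
def IsTracial (ρ : CStarState A) : Prop := ∀ a b : A, ρ (a * b) = ρ (b * a)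

theorem apply_star_mul_self_pos (ρ : CStarState A) (g : Aˣ) :
    0 < ρ (star (g : A) * (g : A)) := by
  refine lt_of_le_of_ne (ρ.nonneg g) fun h0 => ?_
  let _ := CStarAlgebra.spectralOrder A
  let _ := CStarAlgebra.spectralOrderedRing A
  have h1 : star ((↑g⁻¹ : A)) * (↑g⁻¹ : A) ≤ algebraMap ℝ A (‖(↑g⁻¹ : A)‖ ^ 2) :=
    CStarAlgebra.star_mul_le_algebraMap_norm_sq
  have h2 := star_left_conjugate_le_conjugate h1 (g : A)
  have e1 : star (g : A) * (star ((↑g⁻¹ : A)) * (↑g⁻¹ : A)) * g = 1 := by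
    rw [mul_assoc, mul_assoc, Units.inv_mul, mul_one, ← star_mul, Units.inv_mul, star_one]
  have e2 : star (g : A) * algebraMap ℝ A (‖(↑g⁻¹ : A)‖ ^ 2) * g
      = ((‖(↑g⁻¹ : A)‖ ^ 2 : ℝ) : ℂ) • (star (g : A) * g) := by
    rw [Algebra.algebraMap_eq_smul_one, mul_smul_comm, smul_mul_assoc, mul_one]
    rfl
  rw [e1, e2] at h2
  obtain ⟨b, hb⟩ := CStarAlgebra.nonneg_iff_eq_star_mul_self.1 (sub_nonneg.2 h2)
  have h3 := ρ.nonneg b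
  rw [← hb, map_sub, map_smul, ρ.map_one, ← h0, smul_zero, zero_sub] at h3
  have := (Complex.le_def.1 h3).1
  norm_num at this

/-- The action `Φ`: `(Φ_g ρ)(a) = ρ(g† a g) / ρ(g† g)`. -/
noncomputable instance : MulAction Aˣ (CStarState A) where
  smul g ρ :=
    { toCLM := (ρ (star (g : A) * g))⁻¹ •
        (ρ.toCLM ∘L ((ContinuousLinearMap.mul ℂ A (star (g : A))) ∘L
          ((ContinuousLinearMap.mul ℂ A).flip (g : A))))
      nonneg := fun a => by
        have h1 := ρ.apply_star_mul_self_pos g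
        have h2 := ρ.nonneg (a * g)
        have e : star (a * (g : A)) * (a * g) = star (g : A) * (star a * a * g) := by
          simp only [star_mul, mul_assoc]
        rw [e] at h2
        exact mul_nonneg (inv_nonneg.2 h1.le) h2
      map_one := by
        have h1 := ρ.apply_star_mul_self_pos g
        simp [h1.ne'] }
  one_smul ρ := by
    ext a
    change (ρ (star ((1 : Aˣ) : A) * (1 : Aˣ)))⁻¹ * ρ (star ((1 : Aˣ) : A) * (a * (1 : Aˣ))) = ρ a
    simp [ρ.map_one]
  mul_smul g h ρ := by
    ext a
    change (ρ (star ((g * h : Aˣ) : A) * (g * h : Aˣ)))⁻¹ *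
        ρ (star ((g * h : Aˣ) : A) * (a * (g * h : Aˣ))) =
      ((ρ (star (h : A) * h))⁻¹ * ρ (star (h : A) * ((star (g : A) * g) * h)))⁻¹ *
        ((ρ (star (h : A) * h))⁻¹ * ρ (star (h : A) * ((star (g : A) * (a * g)) * h)))
    have h1 := (ρ.apply_star_mul_self_pos h).ne'
    have e1 : star ((g * h : Aˣ) : A) * (g * h : Aˣ) = star (h : A) * ((star (g : A) * g) * h) := by
      simp only [Units.val_mul, star_mul, mul_assoc]
    have e2 : star ((g * h : Aˣ) : A) * (a * (g * h : Aˣ))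
        = star (h : A) * ((star (g : A) * (a * g)) * h) := by
      simp only [Units.val_mul, star_mul, mul_assoc]
    rw [e1, e2, mul_inv, inv_inv]
    field_simp

theorem smul_apply (g : Aˣ) (ρ : CStarState A) (a : A) :
    (g • ρ) a = ρ (star (g : A) * a * g) / ρ (star (g : A) * g) := by
  rw [mul_assoc, div_eq_inv_mul]
  rfl

/-- The elements `g g† / τ(g g†)` with `g` invertible. -/
def normalizedSquares (τ : CStarState A) : Set A :=
  {x | ∃ g : Aˣ, x = (τ ((g : A) * star (g : A)))⁻¹ • ((g : A) * star (g : A))}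

end CStarState

/-! ### The C*-algebra `L^∞(X, ν)` -/

/-- The Banach space `L^∞(X, ν)` of classes of complex-valued essentially bounded functions, with
the essential supremum norm; the instances below make it a C*-algebra for the pointwise operations
(its star is the pointwise complex conjugation). -/
abbrev LInfty {X : Type*} [MeasurableSpace X] (ν : Measure X) : Type _ := Lp ℂ ⊤ ν

namespace LInfty

variable {X : Type*} [MeasurableSpace X] {ν : Measure X}

noncomputable instance instMul : Mul (LInfty ν) :=
  ⟨fun f g => ((Lp.memLp g).mul (Lp.memLp f) : MemLp (⇑f * ⇑g) ⊤ ν).toLp _⟩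

noncomputable instance instOne : One (LInfty ν) :=
  ⟨(memLp_top_const (1 : ℂ)).toLp _⟩

theorem coeFn_mul (f g : LInfty ν) : ∀ᵐ x ∂ν, (f * g) x = f x * g x := MemLp.coeFn_toLp _

theorem coeFn_one : ∀ᵐ x ∂ν, (1 : LInfty ν) x = 1 := MemLp.coeFn_toLp _

theorem coeFn_zero : ∀ᵐ x ∂ν, (0 : LInfty ν) x = 0 := Lp.coeFn_zero ℂ ⊤ ν

theorem coeFn_add (f g : LInfty ν) : ∀ᵐ x ∂ν, (f + g) x = f x + g x := Lp.coeFn_add f g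

theorem coeFn_smul (c : ℂ) (f : LInfty ν) : ∀ᵐ x ∂ν, (c • f) x = c * f x := Lp.coeFn_smul c f

theorem coeFn_star (f : LInfty ν) : ∀ᵐ x ∂ν, (star f) x = star (f x) := Lp.coeFn_star f

theorem ae_norm_le (f : LInfty ν) : ∀ᵐ x ∂ν, ‖f x‖ ≤ ‖f‖ := by
  have h : eLpNorm f ⊤ ν ≠ ⊤ := Lp.eLpNorm_ne_top f
  rw [eLpNorm_exponent_top] at h
  filter_upwards [ae_le_eLpNormEssSup (f := f) (μ := ν)] with x hx
  rw [Lp.norm_def, ← toReal_enorm, eLpNorm_exponent_top]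
  exact ENNReal.toReal_mono h hx

theorem norm_le_of_ae {f : LInfty ν} {C : ℝ} (hC : 0 ≤ C) (h : ∀ᵐ x ∂ν, ‖f x‖ ≤ C) :
    ‖f‖ ≤ C := by
  rw [Lp.norm_def, eLpNorm_exponent_top]
  exact ENNReal.toReal_le_of_le_ofReal hC (eLpNormEssSup_le_of_ae_bound h)

noncomputable instance instNormedCommRing : NormedCommRing (LInfty ν) :=
  { (inferInstance : NormedAddCommGroup (Lp ℂ ⊤ ν)) with
    mul := (· * ·)
    one := 1
    mul_assoc := fun f g h => by
      apply Lp.ext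
      filter_upwards [coeFn_mul (f * g) h, coeFn_mul f g, coeFn_mul f (g * h), coeFn_mul g h]
        with x h1 h2 h3 h4
      rw [h1, h2, h3, h4, mul_assoc]
    mul_comm := fun f g => by
      apply Lp.ext
      filter_upwards [coeFn_mul f g, coeFn_mul g f] with x h1 h2
      rw [h1, h2, mul_comm]
    one_mul := fun f => by
      apply Lp.ext
      filter_upwards [coeFn_mul 1 f, coeFn_one (ν := ν)] with x h1 h2
      rw [h1, h2, one_mul]
    mul_one := fun f => by
      apply Lp.ext
      filter_upwards [coeFn_mul f 1, coeFn_one (ν := ν)] with x h1 h2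
      rw [h1, h2, mul_one]
    zero_mul := fun f => by
      apply Lp.ext
      filter_upwards [coeFn_mul 0 f, coeFn_zero (ν := ν)] with x h1 h2
      rw [h1, h2, zero_mul]
    mul_zero := fun f => by
      apply Lp.ext
      filter_upwards [coeFn_mul f 0, coeFn_zero (ν := ν)] with x h1 h2
      rw [h1, h2, mul_zero]
    left_distrib := fun f g h => by
      apply Lp.ext
      filter_upwards [coeFn_mul f (g + h), coeFn_add g h, coeFn_add (f * g) (f * h),
        coeFn_mul f g, coeFn_mul f h] with x h1 h2 h3 h4 h5
      rw [h1, h2, h3, h4, h5, mul_add]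
    right_distrib := fun f g h => by
      apply Lp.ext
      filter_upwards [coeFn_mul (f + g) h, coeFn_add f g, coeFn_add (f * h) (g * h),
        coeFn_mul f h, coeFn_mul g h] with x h1 h2 h3 h4 h5
      rw [h1, h2, h3, h4, h5, add_mul]
    norm_mul_le := fun f g => by
      refine norm_le_of_ae (by positivity) ?_
      filter_upwards [coeFn_mul f g, ae_norm_le f, ae_norm_le g] with x h1 h2 h3
      rw [h1, norm_mul]
      gcongr }

noncomputable instance instNormedAlgebra : NormedAlgebra ℂ (LInfty ν) :=
  { Algebra.ofModule
      (fun c f g => by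
        apply Lp.ext
        filter_upwards [coeFn_mul (c • f) g, coeFn_smul c f, coeFn_smul c (f * g),
          coeFn_mul f g] with x h1 h2 h3 h4
        rw [h1, h2, h3, h4, mul_assoc])
      (fun c f g => by
        apply Lp.ext
        filter_upwards [coeFn_mul f (c • g), coeFn_smul c g, coeFn_smul c (f * g),
          coeFn_mul f g] with x h1 h2 h3 h4
        rw [h1, h2, h3, h4, mul_left_comm]) with
    norm_smul_le := fun c f => norm_smul_le c f }

noncomputable instance instStarRing : StarRing (LInfty ν) where
  star_mul f g := by
    apply Lp.ext
    filter_upwards [coeFn_star (f * g), coeFn_mul f g, coeFn_mul (star g) (star f),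
      coeFn_star f, coeFn_star g] with x h1 h2 h3 h4 h5
    rw [h1, h2, h3, h4, h5, star_mul]
  star_add f g := by
    apply Lp.ext
    filter_upwards [coeFn_star (f + g), coeFn_add f g, coeFn_add (star f) (star g),
      coeFn_star f, coeFn_star g] with x h1 h2 h3 h4 h5
    rw [h1, h2, h3, h4, h5, star_add]

instance instStarModule : StarModule ℂ (LInfty ν) where
  star_smul c f := by
    apply Lp.ext
    filter_upwards [coeFn_star (c • f), coeFn_smul c f, coeFn_smul (star c) (star f),
      coeFn_star f] with x h1 h2 h3 h4
    rw [h1, h2, h3, h4, star_mul, mul_comm]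

instance instCStarRing : CStarRing (LInfty ν) where
  norm_mul_self_le f := by
    have h : ‖f‖ ≤ √‖star f * f‖ := by
      refine norm_le_of_ae (Real.sqrt_nonneg _) ?_
      filter_upwards [coeFn_mul (star f) f, coeFn_star f, ae_norm_le (star f * f)] with x h1 h2 h3
      refine Real.le_sqrt_of_sq_le ?_
      rwa [h1, h2, norm_mul, norm_star, ← pow_two] at h3
    calc ‖f‖ * ‖f‖ ≤ √‖star f * f‖ * √‖star f * f‖ := by gcongr
      _ = ‖star f * f‖ := Real.mul_self_sqrt (norm_nonneg _)

noncomputable instance instCStarAlgebra : CStarAlgebra (LInfty ν) where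

theorem integrable [IsFiniteMeasure ν] (f : LInfty ν) : Integrable f ν :=
  (Lp.memLp f).integrable le_top

/-- The state `f ↦ ∫ f dν` of `L^∞(X, ν)`, for a probability measure `ν`. -/
noncomputable def integralState (ν : Measure X) [IsProbabilityMeasure ν] :
    CStarState (LInfty ν) where
  toCLM := LinearMap.mkContinuous
    { toFun := fun f => ∫ x, f x ∂ν
      map_add' := fun f g => by
        rw [integral_congr_ae (coeFn_add f g), integral_add (integrable f) (integrable g)]
      map_smul' := fun c f => by
        rw [integral_congr_ae (coeFn_smul c f), integral_const_mul]; rfl } 1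
    (fun f => by
      have h := norm_integral_le_of_norm_le_const (ae_norm_le f)
      simpa [mul_comm] using h)
  nonneg f := by
    change 0 ≤ ∫ x, (star f * f) x ∂ν
    have h : ∀ᵐ x ∂ν, (star f * f) x = ((‖f x‖ ^ 2 : ℝ) : ℂ) := by
      filter_upwards [coeFn_mul (star f) f, coeFn_star f] with x h1 h2
      rw [h1, h2, ← starRingEnd_apply, Complex.conj_mul', Complex.ofReal_pow]
    rw [integral_congr_ae h, integral_complex_ofReal]
    exact Complex.zero_le_real.2 (integral_nonneg fun x => by positivity)
  map_one := by
    change ∫ x, (1 : LInfty ν) x ∂ν = 1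
    rw [integral_congr_ae (coeFn_one (ν := ν))]
    simp

/-- The probability densities with respect to `ν` that are strictly positive elements of
`L^∞(X, ν)`: real, bounded, bounded below a.e. by a positive constant, of integral `1`. -/
def strictlyPositiveDensities (ν : Measure X) : Set (LInfty ν) :=
  {f | (∃ c : ℝ, 0 < c ∧ ∀ᵐ x ∂ν, (c : ℂ) ≤ f x) ∧ ∫ x, f x ∂ν = 1}

end LInfty

/-! ### Orbits of the unit group of a Banach algebra -/

section AdaptedCharts

open Filter Topology

/-! Traciality turns `τ (g† a g)` into `τ (g g† a)`, so `g • τ` has density `N g = g g† / τ (g g†)`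
with respect to `τ`, and faithfulness makes this density unique. Hence `N` separates exactly the
points of the orbit. Its values are the positive invertible elements of trace one, because such an
element has an invertible square root.

The smooth structure is read off from `N`. The element `N g - 1` lies in the real Banach space of
self-adjoint elements with `τ = 0`, which is the range of a bounded projection of `A`. The
derivative of `N` at a unit is a linear automorphism of `A` followed by this projection
(`hasFDerivAt_normalizedSquare`). By the inverse function theorem, `N` becomes a linear projection
in suitable charts, so the isotropy group is locally its kernel. The induced injection of the coset
space into the model space is an open embedding and serves as a single global chart
(`of_equivariant_submersion`). In this chart the action is conjugation of the density followed by
renormalization, which is smooth.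

In finite dimension every functional has a density with respect to `τ`; faithfulness of the state
makes this density positive and invertible, so all faithful states lie on the orbit. On `ℂ^n` these
are the open simplex. On `L^∞`, being positive and invertible means being bounded below by a
positive constant. -/

/-- If the derivative of `φ` at `x` is a linear automorphism followed by the split surjection `P`,
then there is a local diffeomorphism around `x` in which `φ` becomes `P`. -/
theorem exists_openPartialHomeomorph_comp_eq {E F : Type*} [NormedAddCommGroup E] [NormedSpace ℝ E]
    [CompleteSpace E] [NormedAddCommGroup F] [NormedSpace ℝ F] {φ : E → F} {P : E →L[ℝ] F}
    {i : F →L[ℝ] E} (hi : Function.RightInverse i P) {x : E} (L : E ≃L[ℝ] E)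
    (hφ : ∀ᶠ y in 𝓝 x, ContDiffAt ℝ ∞ φ y) (hd : HasFDerivAt φ (P ∘L (L : E →L[ℝ] E)) x) :
    ∃ e : OpenPartialHomeomorph E E, x ∈ e.source ∧ ContDiffOn ℝ ∞ e e.source ∧
      ContDiffOn ℝ ∞ e.symm e.target ∧ ∀ y ∈ e.source, P (e y) = φ y := by
  -- Since `P ∘ i = id`, the second summand takes values in `ker P` and `P ∘ Ψ = φ` everywhere. At
  -- `x` the two terms `i P L` of the derivative cancel and leave `L`.
  let Ψ : E → E := fun y => i (φ y) + (L y - i (P (L y)))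
  have hΨ : ∀ᶠ y in 𝓝 x, ContDiffAt ℝ ∞ Ψ y := by
    filter_upwards [hφ] with y hy
    exact (i.contDiff.contDiffAt.comp y hy).add
      (L.contDiff.contDiffAt.sub
        (i.contDiff.contDiffAt.comp y (P.contDiff.contDiffAt.comp y L.contDiff.contDiffAt)))
  have hΨd : HasFDerivAt Ψ (L : E →L[ℝ] E) x := by
    have h := (i.hasFDerivAt.comp x hd).add
      (L.hasFDerivAt.sub ((i ∘L (P ∘L (L : E →L[ℝ] E))).hasFDerivAt (x := x)))
    refine h.congr_fderiv ?_
    ext v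
    simp
  -- The inverse must be smooth on the whole target, not only at the image of `x`; so the domain is
  -- shrunk to points where the derivative stays invertible.
  have hinv : ∀ᶠ y in 𝓝 x, fderiv ℝ Ψ y ∈ Set.range ((↑) : (E ≃L[ℝ] E) → E →L[ℝ] E) := by
    have hc : ContinuousAt (fderiv ℝ Ψ) x :=
      (hΨ.self_of_nhds.fderiv_right (m := 0) (by simp)).continuousAt
    refine hc ?_
    rw [hΨd.fderiv]
    exact ContinuousLinearEquiv.nhds L
  obtain ⟨s, hs, hso, hxs⟩ := eventually_nhds_iff.1 (hΨ.and hinv)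
  let e₀ := hΨ.self_of_nhds.toOpenPartialHomeomorph Ψ hΨd (by simp)
  have hx₀ : x ∈ e₀.source := hΨ.self_of_nhds.mem_toOpenPartialHomeomorph_source hΨd (by simp)
  have hsrc : (e₀.restr s).source = e₀.source ∩ s := e₀.restr_source' s hso
  refine ⟨e₀.restr s, ?_, ?_, ?_, ?_⟩
  · rw [hsrc]
    exact ⟨hx₀, hxs⟩
  · intro y hy
    rw [hsrc] at hy
    exact (hs y hy.2).1.contDiffWithinAt
  · intro z hz
    have hy := (e₀.restr s).map_target hz
    rw [hsrc] at hy
    obtain ⟨h1, f', h2⟩ := hs _ hy.2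
    refine ((e₀.restr s).contDiffAt_symm hz (f₀' := f') ?_ h1).contDiffWithinAt
    rw [h2]
    exact (h1.differentiableAt (by simp)).hasFDerivAt
  · intro y _
    change P (i (φ y) + (L y - i (P (L y)))) = φ y
    rw [map_add, map_sub, hi, hi, sub_self, add_zero]

variable {A : Type u} [NormedRing A] [NormedAlgebra ℝ A] [CompleteSpace A]
  {F : Type u} [NormedAddCommGroup F] [NormedSpace ℝ F] {φ : A → F} {P : A →L[ℝ] F} {i : F →L[ℝ] A}

/-- A map on the units whose derivatives are automorphisms followed by the split surjection `P`
becomes `P` in suitable charts of the units. -/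
theorem Units.exists_chart_comp_eq (hi : Function.RightInverse i P) (g : Aˣ) (L : A ≃L[ℝ] A)
    (hφ : ∀ g : Aˣ, ContDiffAt ℝ ∞ φ g) (hd : HasFDerivAt φ (P ∘L (L : A →L[ℝ] A)) (g : A)) :
    ∃ e ∈ IsManifold.maximalAtlas 𝓘(ℝ, A) ∞ Aˣ, g ∈ e.source ∧
      ∀ y ∈ e.source, P (e y) = φ (y : A) := by
  have hev : ∀ᶠ y in 𝓝 (g : A), ContDiffAt ℝ ∞ φ y := by
    filter_upwards [Units.isOpen.mem_nhds g.isUnit] with y hy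
    exact hφ (IsUnit.unit hy)
  obtain ⟨e, hge, he, he', heP⟩ := exists_openPartialHomeomorph_comp_eq hi L hev hd
  have hc := IsManifold.chart_mem_maximalAtlas (I := 𝓘(ℝ, A)) (n := ∞) g
  refine ⟨(chartAt A g).trans e, ?_, ?_, ?_⟩
  · apply OpenPartialHomeomorph.mem_maximalAtlas_of_contMDiffOn
    · refine (contMDiffOn_iff_contDiffOn.2 he).comp
        ((contMDiffOn_of_mem_maximalAtlas hc).mono fun y hy => hy.1) fun y hy => hy.2
    · refine (contMDiffOn_symm_of_mem_maximalAtlas hc).comp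
        ((contMDiffOn_iff_contDiffOn.2 he').mono fun y hy => hy.1) fun y hy => hy.2
  · rw [OpenPartialHomeomorph.trans_source]
    exact ⟨mem_chart_source A g, hge⟩
  · intro y hy
    rw [OpenPartialHomeomorph.trans_source] at hy
    exact heP _ hy.2

/-- A map from the units to a manifold given by one chart `ι` is a submersion if, read in that
chart, its derivatives are automorphisms followed by a fixed split surjection. -/
theorem Units.isSubmersion_of_comp_isOpenEmbedding (hi : Function.RightInverse i P)
    (hφ : ∀ g : Aˣ, ContDiffAt ℝ ∞ φ g)
    (hd : ∀ g : Aˣ, ∃ L : A ≃L[ℝ] A, HasFDerivAt φ (P ∘L (L : A →L[ℝ] A)) (g : A))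
    {M : Type*} [TopologicalSpace M] [Nonempty M] {ι : M → F} (hι : IsOpenEmbedding ι)
    {f : Aˣ → M} (hf : ∀ g : Aˣ, ι (f g) = φ g) :
    letI := hι.singletonChartedSpace
    Manifold.IsSubmersion 𝓘(ℝ, A) 𝓘(ℝ, F) ∞ f := by
  let _ := hι.singletonChartedSpace
  have : IsManifold 𝓘(ℝ, F) ∞ M := hι.isManifold_singleton
  refine ⟨P.ker, inferInstance, inferInstance, fun g => ?_⟩
  obtain ⟨L, hL⟩ := hd g
  obtain ⟨e, he, hge, heP⟩ := Units.exists_chart_comp_eq hi g L hφ hL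
  refine Manifold.IsSubmersionAtOfComplement.mk_of_charts
    (ContinuousLinearEquiv.equivOfRightInverse P i hi) e (chartAt F (f g)) hge
    (mem_chart_source F (f g)) he (IsManifold.chart_mem_maximalAtlas _) ?_ ?_
  · intro y _
    change f y ∈ Set.univ
    trivial
  · intro z hz
    have hz' : z ∈ e.target := by simpa using hz
    have h1 : P (e (e.symm z)) = φ ((e.symm z : Aˣ) : A) := heP _ (e.map_target hz')
    rw [e.right_inv hz'] at h1
    have h2 : ι (f (e.symm z)) = P z := by rw [hf, h1]
    simpa using h2

/-- The derivatives are surjective and the units are open in `A`. This openness is what makes the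
map induced on the coset space an open embedding. -/
theorem Units.isOpenMap_of_hasFDerivAt [CompleteSpace F] (hi : Function.RightInverse i P)
    (hφ : ∀ g : Aˣ, ContDiffAt ℝ ∞ φ g)
    (hd : ∀ g : Aˣ, ∃ L : A ≃L[ℝ] A, HasFDerivAt φ (P ∘L (L : A →L[ℝ] A)) (g : A)) :
    IsOpenMap fun g : Aˣ => φ g := by
  rw [isOpenMap_iff_nhds_le]
  intro g
  obtain ⟨L, hL⟩ := hd g
  have hs := (hφ g).hasStrictFDerivAt' hL (by simp)
  have h := hs.map_nhds_eq_of_surj (by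
    rw [LinearMap.range_eq_top]
    intro y
    exact ⟨L.symm (i y), by simp [hi y]⟩)
  rw [← h, ← Units.isOpenEmbedding_val.map_nhds_eq g, Filter.map_map]
  rfl

end AdaptedCharts

/-! ### Manifold structure on the coset space and on the orbit from one global chart. -/

section SmoothOrbits

open Topology

variable {A : Type u} [NormedRing A] [NormedAlgebra ℝ A] [CompleteSpace A]
  {F : Type u} [NormedAddCommGroup F] [NormedSpace ℝ F]

/-- Smoothness of a transitive action on a manifold given by one chart `ι`. -/
theorem Units.contMDiff_smul_of_isOpenEmbedding {M : Type*} [TopologicalSpace M] [Nonempty M]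
    [SMul Aˣ M] {ι : M → F} (hι : IsOpenEmbedding ι) (ψ : A × F → F)
    (hψ : ∀ (g : Aˣ) (m : M), ContDiffAt ℝ ∞ ψ (g, ι m))
    (hψι : ∀ (g : Aˣ) (m : M), ι (g • m) = ψ (g, ι m)) :
    letI := hι.singletonChartedSpace
    ContMDiff (𝓘(ℝ, A).prod 𝓘(ℝ, F)) 𝓘(ℝ, F) ∞ (fun p : Aˣ × M => p.1 • p.2) := by
  let _ := hι.singletonChartedSpace
  refine ContMDiff.of_comp_isOpenEmbedding hι ?_
  have h1 : ContMDiff (𝓘(ℝ, A).prod 𝓘(ℝ, F)) 𝓘(ℝ, A × F) ∞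
      (fun p : Aˣ × M => ((p.1 : A), ι p.2)) :=
    (Units.contMDiff_val.comp contMDiff_fst).prodMk_space
      ((contMDiff_isOpenEmbedding hι).comp contMDiff_snd)
  have h2 : ι ∘ (fun p : Aˣ × M => p.1 • p.2) = ψ ∘ fun p : Aˣ × M => ((p.1 : A), ι p.2) := by
    ext p
    exact hψι p.1 p.2
  rw [h2]
  exact fun p => ContMDiffAt.comp p (contMDiffAt_iff_contDiffAt.2 (hψ p.1 p.2)) (h1 p)

/-- A criterion for an orbit of the unit group of a Banach algebra to be a homogeneous Banach
manifold: a smooth map `φ` on the units that separates exactly the points of the orbit, whose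
derivatives are automorphisms followed by a fixed split surjection `P`, and through which the
action is smooth. -/
theorem IsHomogeneousBanachManifoldOrbit.of_equivariant_submersion [CompleteSpace F]
    {S : Type u} [MulAction Aˣ S] (s : S) (φ : A → F) (P : A →L[ℝ] F) (i : F →L[ℝ] A)
    (ψ : A × F → F)
    (hi : Function.RightInverse i P)
    (hφ : ∀ g : Aˣ, ContDiffAt ℝ ∞ φ g)
    (hd : ∀ g : Aˣ, ∃ L : A ≃L[ℝ] A, HasFDerivAt φ (P ∘L (L : A →L[ℝ] A)) (g : A))
    (hφ1 : φ 1 = 0)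
    (hs : ∀ g h : Aˣ, φ g = φ h ↔ g • s = h • s)
    (hψ : ∀ g h : Aˣ, ContDiffAt ℝ ∞ ψ (g, φ h))
    (hψφ : ∀ g h : Aˣ, φ ((g * h : Aˣ) : A) = ψ (g, φ h)) :
    IsHomogeneousBanachManifoldOrbit A Aˣ s := by
  -- The isotropy group is the zero set of `φ`, which is `ker P` in the charts adapted to `φ`.
  have hstab : ∀ g : Aˣ, g ∈ MulAction.stabilizer Aˣ s ↔ φ g = 0 := fun g => by
    rw [MulAction.mem_stabilizer_iff, ← hφ1, ← Units.val_one, hs, one_smul]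
  refine ⟨fun g hg => ?_, ?_⟩
  · obtain ⟨L, hL⟩ := hd g
    obtain ⟨e, he, hge, heP⟩ := Units.exists_chart_comp_eq hi g L hφ hL
    refine ⟨e, he, hge, P.ker, P.closedComplemented_ker_of_rightInverse i hi, fun y hy => ?_⟩
    rw [hstab, ← heP y hy]
    exact LinearMap.mem_ker.symm
  · let K := MulAction.stabilizer Aˣ s
    have hrel : ∀ g h : Aˣ, g⁻¹ * h ∈ K ↔ φ g = φ h := fun g h => by
      rw [hs, MulAction.mem_stabilizer_iff, mul_smul, inv_smul_eq_iff, eq_comm]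
    let ι : Aˣ ⧸ K → F := fun q => q.liftOn (fun g : Aˣ => φ g) fun g h hgh =>
      (hrel g h).1 (QuotientGroup.leftRel_apply.1 hgh)
    have hιmk : ∀ g : Aˣ, ι (QuotientGroup.mk g) = φ g := fun g => rfl
    have hcont : Continuous fun g : Aˣ => φ g := continuous_iff_continuousAt.2 fun g =>
      ContinuousAt.comp (hφ g).continuousAt Units.continuous_val.continuousAt
    have hι : IsOpenEmbedding ι := by
      refine IsOpenEmbedding.of_continuous_injective_isOpenMap ?_ ?_ ?_
      · exact hcont.quotient_lift _
      · intro q r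
        induction q using QuotientGroup.induction_on with | H g => ?_
        induction r using QuotientGroup.induction_on with | H h => ?_
        intro hgh
        exact QuotientGroup.eq.2 ((hrel g h).2 hgh)
      · intro U hU
        have h := Units.isOpenMap_of_hasFDerivAt hi hφ hd _
          (hU.preimage (QuotientGroup.continuous_mk (N := K)))
        convert h using 1
        ext y
        constructor
        · rintro ⟨q, hq, rfl⟩
          induction q using QuotientGroup.induction_on with | H g => ?_
          exact ⟨g, hq, rfl⟩
        · rintro ⟨g, hg, rfl⟩
          exact ⟨_, hg, rfl⟩
    let E := MulAction.orbitEquivQuotientStabilizer Aˣ s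
    -- The orbit receives its topology from the coset space, so that the canonical bijection is a
    -- homeomorphism and `ι ∘ E` is again an open embedding.
    let tO : TopologicalSpace (MulAction.orbit Aˣ s) := TopologicalSpace.induced E inferInstance
    let Eh : MulAction.orbit Aˣ s ≃ₜ Aˣ ⧸ K := E.toHomeomorphOfIsInducing ⟨rfl⟩
    have : Nonempty (MulAction.orbit Aˣ s) := ⟨⟨s, MulAction.mem_orbit_self s⟩⟩
    have hκ : IsOpenEmbedding (ι ∘ E) := hι.comp Eh.isOpenEmbedding
    have hκmk : ∀ g : Aˣ, (ι ∘ E) ⟨g • s, MulAction.mem_orbit s g⟩ = φ g := fun g => by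
      have : E ⟨g • s, MulAction.mem_orbit s g⟩ = QuotientGroup.mk g := by
        rw [← Equiv.eq_symm_apply]
        ext
        exact (MulAction.orbitEquivQuotientStabilizer_symm_apply Aˣ s g).symm
      rw [Function.comp_apply, this, hιmk]
    let cQ : ChartedSpace F (Aˣ ⧸ K) := hι.singletonChartedSpace
    let cO : ChartedSpace F (MulAction.orbit Aˣ s) := hκ.singletonChartedSpace
    have hιs : ContMDiff 𝓘(ℝ, F) 𝓘(ℝ, F) ∞ ι := contMDiff_isOpenEmbedding hι
    have hκs : ContMDiff 𝓘(ℝ, F) 𝓘(ℝ, F) ∞ (ι ∘ E) := contMDiff_isOpenEmbedding hκ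
    refine ⟨F, inferInstance, inferInstance, inferInstance, cQ, tO, cO, ?_, ?_, ?_, ?_, ?_, ?_, ?_⟩
    · refine ⟨hι.isManifold_singleton, hι.isEmbedding.t2Space, ?_, ?_⟩
      · exact Units.isSubmersion_of_comp_isOpenEmbedding hi hφ hd hι hιmk
      · refine Units.contMDiff_smul_of_isOpenEmbedding hι ψ ?_ ?_
        · intro g q
          induction q using QuotientGroup.induction_on with | H h => ?_
          exact hψ g h
        · intro g q
          induction q using QuotientGroup.induction_on with | H h => ?_
          exact hψφ g h
    · exact hκ.isEmbedding.t2Space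
    · exact hκ.isManifold_singleton
    · exact ContMDiff.of_comp_isOpenEmbedding hι hκs
    · refine ContMDiff.of_comp_isOpenEmbedding hκ ?_
      have : (ι ∘ E) ∘ E.symm = ι := by
        ext q
        simp
      change ContMDiff 𝓘(ℝ, F) 𝓘(ℝ, F) ∞ ((ι ∘ E) ∘ E.symm)
      rwa [this]
    · exact Units.isSubmersion_of_comp_isOpenEmbedding hi hφ hd hκ hκmk
    · refine Units.contMDiff_smul_of_isOpenEmbedding hκ ψ ?_ ?_
      · rintro g ⟨_, h, rfl⟩
        rw [hκmk]
        exact hψ g h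
      · rintro g ⟨_, h, rfl⟩
        rw [hκmk, ← hψφ, ← hκmk (g * h)]
        congr 1
        ext1
        exact (mul_smul g h s).symm

end SmoothOrbits

/-! ### The orbit of a faithful tracial state -/

namespace CStarState

variable {A : Type u} [CStarAlgebra A] {τ : CStarState A}

/-- Polarization: `τ` is real on `b† b` for `b = a`, `a + 1` and `a + i`; comparing imaginary parts
gives those of `τ (a†) + τ a` and `i (τ (a†) - τ a)` as zero. -/
theorem map_star (τ : CStarState A) (a : A) : τ (star a) = star (τ a) := by
  have him : ∀ b : A, (τ (star b * b)).im = 0 := fun b => (Complex.le_def.1 (τ.nonneg b)).2.symm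
  have h0 := him a
  have h1 := him (a + 1)
  have h2 := him (a + Complex.I • (1 : A))
  have e1 : star (a + 1) * (a + 1) = star a * a + star a + a + 1 := by
    rw [star_add, star_one]; noncomm_ring
  have e2 : star (a + Complex.I • (1 : A)) * (a + Complex.I • (1 : A)) =
      star a * a + Complex.I • star a - Complex.I • a + 1 := by
    rw [star_add, star_smul, star_one, add_mul, mul_add, mul_add, mul_smul_comm, smul_mul_assoc,
      smul_mul_assoc, mul_smul_comm, smul_smul, mul_one, one_mul, mul_one]
    simp
    abel
  rw [e1] at h1
  rw [e2] at h2
  simp only [map_add, map_sub, map_smul, τ.map_one, Complex.add_im, Complex.sub_im, smul_eq_mul,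
    Complex.mul_im, Complex.I_re, Complex.I_im, Complex.one_im] at h1 h2
  apply Complex.ext
  · rw [Complex.star_def, Complex.conj_re]; linarith
  · rw [Complex.star_def, Complex.conj_im]; linarith

/-- The real part of a state, as a real functional. -/
noncomputable def reCLM (τ : CStarState A) : A →L[ℝ] ℝ :=
  Complex.reCLM ∘L τ.toCLM.restrictScalars ℝ

theorem reCLM_apply (τ : CStarState A) (a : A) : τ.reCLM a = (τ a).re := rfl

theorem reCLM_star (τ : CStarState A) (a : A) : τ.reCLM (star a) = τ.reCLM a := by
  rw [reCLM_apply, map_star, Complex.star_def, Complex.conj_re, reCLM_apply]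

theorem reCLM_one (τ : CStarState A) : τ.reCLM 1 = 1 := by
  rw [reCLM_apply, τ.map_one, Complex.one_re]

theorem coe_reCLM_of_isSelfAdjoint (τ : CStarState A) {a : A} (ha : IsSelfAdjoint a) :
    (τ.reCLM a : ℂ) = τ a := by
  rw [reCLM_apply]
  refine Complex.conj_eq_iff_re.1 ?_
  rw [← Complex.star_def, ← map_star, ha.star_eq]

theorem IsFaithful.ext_mul (hf : τ.IsFaithful) {x y : A} (h : ∀ a, τ (a * x) = τ (a * y)) :
    x = y := by
  by_contra hxy
  have h1 := hf (x - y) (sub_ne_zero.2 hxy)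
  rw [mul_sub, map_sub, h, sub_self] at h1
  exact lt_irrefl _ h1

theorem IsTracial.apply_mul_star_self_pos (ht : τ.IsTracial) (g : Aˣ) :
    0 < τ ((g : A) * star (g : A)) := by
  rw [ht]
  exact τ.apply_star_mul_self_pos g

/-- The element `a a† / τ(a a†)`. -/
noncomputable def normalizedSquare (τ : CStarState A) (a : A) : A :=
  (τ (a * star a))⁻¹ • (a * star a)

theorem normalizedSquare_eq_reCLM (τ : CStarState A) (a : A) :
    τ.normalizedSquare a = (τ.reCLM (a * star a))⁻¹ • (a * star a) := by
  rw [normalizedSquare, ← coe_reCLM_of_isSelfAdjoint τ (IsSelfAdjoint.mul_star_self a),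
    ← Complex.ofReal_inv, Complex.coe_smul]

theorem isSelfAdjoint_normalizedSquare (τ : CStarState A) (a : A) :
    IsSelfAdjoint (τ.normalizedSquare a) := by
  rw [normalizedSquare_eq_reCLM]
  exact (IsSelfAdjoint.all (_ : ℝ)).smul (IsSelfAdjoint.mul_star_self a)

theorem IsTracial.apply_normalizedSquare (ht : τ.IsTracial) (g : Aˣ) :
    τ (τ.normalizedSquare g) = 1 := by
  rw [normalizedSquare, map_smul, smul_eq_mul,
    inv_mul_cancel₀ (ht.apply_mul_star_self_pos g).ne']

theorem normalizedSquare_one (τ : CStarState A) : τ.normalizedSquare 1 = 1 := by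
  simp [normalizedSquare, τ.map_one]

/-- Cyclicity of the trace moves `g` to the front, so the normalized square is the density of `g •
τ`. -/
theorem IsTracial.smul_apply (ht : τ.IsTracial) (g : Aˣ) (a : A) :
    (g • τ) a = τ (τ.normalizedSquare g * a) := by
  rw [CStarState.smul_apply, normalizedSquare, smul_mul_assoc, map_smul, smul_eq_mul, div_eq_inv_mul,
    ht (star (g : A)) g, mul_assoc, ht (star (g : A)), mul_assoc, ht a]

theorem IsFaithful.normalizedSquare_eq_iff (hf : τ.IsFaithful) (ht : τ.IsTracial) (g h : Aˣ) :
    τ.normalizedSquare g = τ.normalizedSquare h ↔ g • τ = h • τ := by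
  constructor
  · intro hgh
    ext a
    rw [ht.smul_apply, ht.smul_apply, hgh]
  · intro hgh
    refine hf.ext_mul fun a => ?_
    rw [ht a, ht a, ← ht.smul_apply, ← ht.smul_apply, hgh]

theorem normalizedSquare_smul (τ : CStarState A) {c : ℂ} (hc : c ≠ 0) (a : A) :
    (τ (c • a))⁻¹ • (c • a) = (τ a)⁻¹ • a := by
  rw [map_smul, smul_eq_mul, smul_smul, mul_inv, mul_comm c⁻¹, mul_assoc, inv_mul_cancel₀ hc,
    mul_one]

/-- The action depends on `h` only through its density, as the factor `τ (h h†)` cancels on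
renormalizing. This provides the map `ψ` of the equivariance criterion. -/
theorem IsTracial.normalizedSquare_mul (ht : τ.IsTracial) (g h : Aˣ) :
    τ.normalizedSquare (g * h : Aˣ) =
      (τ ((g : A) * τ.normalizedSquare h * star (g : A)))⁻¹ •
        ((g : A) * τ.normalizedSquare h * star (g : A)) := by
  have e : ((g * h : Aˣ) : A) * star ((g * h : Aˣ) : A) =
      (g : A) * ((h : A) * star (h : A)) * star (g : A) := by
    rw [Units.val_mul, star_mul]; noncomm_ring
  have e' : (g : A) * τ.normalizedSquare h * star (g : A) = (τ ((h : A) * star (h : A)))⁻¹ •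
      ((g : A) * ((h : A) * star (h : A)) * star (g : A)) := by
    rw [normalizedSquare, mul_smul_comm, smul_mul_assoc]
  rw [normalizedSquare, e, e',
    normalizedSquare_smul τ (inv_ne_zero (ht.apply_mul_star_self_pos h).ne')]

/-- The projection `a ↦ (a + a†)/2 - Re τ(a)` onto the self-adjoint elements annihilated by `τ`. -/
noncomputable def tangentProj (τ : CStarState A) : A →L[ℝ] A :=
  (2⁻¹ : ℝ) • (ContinuousLinearMap.id ℝ A + ((starL' ℝ : A ≃L[ℝ] A) : A →L[ℝ] A)) -
    τ.reCLM.smulRight (1 : A)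

theorem tangentProj_apply (τ : CStarState A) (a : A) :
    τ.tangentProj a = (2⁻¹ : ℝ) • (a + star a) - τ.reCLM a • (1 : A) := rfl

theorem star_tangentProj (τ : CStarState A) (a : A) :
    star (τ.tangentProj a) = τ.tangentProj a := by
  simp only [tangentProj_apply, star_sub, star_smul, star_add, star_star, star_one, star_trivial,
    add_comm]

theorem reCLM_tangentProj (τ : CStarState A) (a : A) : τ.reCLM (τ.tangentProj a) = 0 := by
  simp only [tangentProj_apply, map_sub, map_smul, map_add, reCLM_star, reCLM_one, smul_eq_mul]
  ring

theorem tangentProj_eq_self (τ : CStarState A) {a : A} (ha : star a = a) (h0 : τ.reCLM a = 0) :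
    τ.tangentProj a = a := by
  rw [tangentProj_apply, ha, h0, zero_smul, sub_zero, ← two_smul ℝ, smul_smul]
  norm_num

/-- The real Banach space of self-adjoint elements annihilated by `τ`, on which the orbit of a
faithful tracial state is modelled. -/
noncomputable abbrev tangentModel (τ : CStarState A) : Submodule ℝ A :=
  (τ.tangentProj - ContinuousLinearMap.id ℝ A).ker

theorem mem_tangentModel_iff (τ : CStarState A) {a : A} :
    a ∈ τ.tangentModel ↔ star a = a ∧ τ.reCLM a = 0 := by
  rw [LinearMap.mem_ker]
  constructor
  · intro h
    have h' : τ.tangentProj a = a := sub_eq_zero.1 h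
    rw [← h']
    exact ⟨τ.star_tangentProj a, τ.reCLM_tangentProj a⟩
  · rintro ⟨h1, h2⟩
    exact sub_eq_zero.2 (τ.tangentProj_eq_self h1 h2)

/-- The projection onto the model space, as a map to it. -/
noncomputable def toTangentModel (τ : CStarState A) : A →L[ℝ] τ.tangentModel :=
  τ.tangentProj.codRestrict _ fun a =>
    τ.mem_tangentModel_iff.2 ⟨τ.star_tangentProj a, τ.reCLM_tangentProj a⟩

theorem coe_toTangentModel (τ : CStarState A) (a : A) :
    (τ.toTangentModel a : A) = τ.tangentProj a := rfl

theorem toTangentModel_rightInverse (τ : CStarState A) :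
    Function.RightInverse τ.tangentModel.subtypeL τ.toTangentModel := by
  rintro ⟨a, ha⟩
  ext
  obtain ⟨h1, h2⟩ := τ.mem_tangentModel_iff.1 ha
  exact τ.tangentProj_eq_self h1 h2

theorem coe_toTangentModel_of_apply_eq_one (τ : CStarState A) {x : A} (hx : IsSelfAdjoint x)
    (h1 : τ x = 1) : (τ.toTangentModel x : A) = x - 1 := by
  rw [coe_toTangentModel, tangentProj_apply, hx.star_eq, reCLM_apply, h1, Complex.one_re, one_smul,
    ← two_smul ℝ, smul_smul]
  norm_num

/-- A linear automorphism of `A` which, followed by the projection onto the model space, gives the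
derivative of the normalized square at a point `g` with `τ(g g†) = t` and `g g† = t x`,
up to right multiplication by `g†`. -/
noncomputable def squareEquiv (τ : CStarState A) {x : A} (hx : IsSelfAdjoint x) (h1 : τ.reCLM x = 1)
    {t : ℝ} (ht : t ≠ 0) : A ≃L[ℝ] A :=
  ContinuousLinearEquiv.equivOfInverse
    -- The first summand is the actual derivative. The skew part and the multiple of `1` are killed
    -- by `tangentProj` and are added only to make the map invertible: since `τ x = 1`, the first
    -- summand has trace zero, so `τ w` and the skew part of `w` can be recovered from the image.
    ((2 / t) • ((2⁻¹ : ℝ) • (ContinuousLinearMap.id ℝ A + ((starL' ℝ : A ≃L[ℝ] A) : A →L[ℝ] A)) -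
      τ.reCLM.smulRight x) +
      (2⁻¹ : ℝ) • (ContinuousLinearMap.id ℝ A - ((starL' ℝ : A ≃L[ℝ] A) : A →L[ℝ] A)) +
      τ.reCLM.smulRight (1 : A))
    ((t / 2) • τ.tangentProj + τ.reCLM.smulRight x +
      (2⁻¹ : ℝ) • (ContinuousLinearMap.id ℝ A - ((starL' ℝ : A ≃L[ℝ] A) : A →L[ℝ] A)))
    (fun w => by
      simp [tangentProj_apply, reCLM_star, reCLM_one, h1, hx.star_eq]
      match_scalars <;> field_simp <;> ring)
    (fun w => by
      simp [tangentProj_apply, reCLM_star, reCLM_one, h1, hx.star_eq]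
      match_scalars <;> field_simp <;> ring)

theorem toTangentModel_squareEquiv (τ : CStarState A) {x : A} (hx : IsSelfAdjoint x)
    (h1 : τ.reCLM x = 1) {t : ℝ} (ht : t ≠ 0) (w : A) :
    τ.toTangentModel (τ.squareEquiv hx h1 ht w) =
      τ.toTangentModel (t⁻¹ • (w + star w) - (2 / t * τ.reCLM w) • x) := by
  ext
  simp [coe_toTangentModel, squareEquiv, tangentProj_apply, reCLM_star, reCLM_one, h1, hx.star_eq]
  match_scalars <;> field_simp <;> ring

theorem contDiffAt_inv_reCLM_smul (τ : CStarState A) {E : Type*} [NormedAddCommGroup E]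
    [NormedSpace ℝ E] {f : E → A} {e : E} (hf : ContDiffAt ℝ ∞ f e) (h0 : τ.reCLM (f e) ≠ 0) :
    ContDiffAt ℝ ∞ (fun e => (τ.reCLM (f e))⁻¹ • f e) e :=
  ((τ.reCLM.contDiff.contDiffAt.comp e hf).inv h0).smul hf

theorem contDiff_mul_star : ContDiff ℝ ∞ fun a : A => a * star a :=
  contDiff_id.mul (starL' ℝ : A ≃L[ℝ] A).contDiff

theorem IsTracial.reCLM_mul_star_self_pos (ht : τ.IsTracial) (g : Aˣ) :
    0 < τ.reCLM ((g : A) * star (g : A)) := by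
  have h := ht.apply_mul_star_self_pos g
  rw [← coe_reCLM_of_isSelfAdjoint τ (IsSelfAdjoint.mul_star_self _)] at h
  exact_mod_cast h

/-- With `w = v g†` and `t = τ (g g†)`, the quotient rule gives the derivative `(w + w†) / t - (2 Re
τ(w) / t) N g` in direction `v`. The map `v ↦ v g†` is invertible because `g` is. -/
theorem IsTracial.hasFDerivAt_normalizedSquare (ht : τ.IsTracial) (g : Aˣ) :
    ∃ L : A ≃L[ℝ] A, HasFDerivAt (fun a => τ.toTangentModel (τ.normalizedSquare a))
      (τ.toTangentModel ∘L (L : A →L[ℝ] A)) (g : A) := by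
  have hpos := ht.reCLM_mul_star_self_pos g
  have h1 : τ.reCLM (τ.normalizedSquare g) = 1 := by
    rw [reCLM_apply, ht.apply_normalizedSquare, Complex.one_re]
  let R : A ≃L[ℝ] A := ContinuousLinearEquiv.equivOfInverse
    ((ContinuousLinearMap.mul ℝ A).flip (star g : Aˣ))
    ((ContinuousLinearMap.mul ℝ A).flip ((star g : Aˣ)⁻¹ : Aˣ))
    (fun a => by simp [mul_assoc, ← star_mul]) (fun a => by simp [mul_assoc, ← star_mul])
  refine ⟨R.trans (τ.squareEquiv (τ.isSelfAdjoint_normalizedSquare g) h1 hpos.ne'), ?_⟩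
  have hq : HasFDerivAt (fun a : A => a * star a) _ (g : A) :=
    (hasFDerivAt_id (𝕜 := ℝ) (g : A)).mul' ((starL' ℝ : A ≃L[ℝ] A).hasFDerivAt)
  have hN := ((hasDerivAt_inv hpos.ne').comp_hasFDerivAt (g : A)
    (τ.reCLM.hasFDerivAt.comp (g : A) hq)).smul hq
  have hP := τ.toTangentModel.hasFDerivAt.comp (g : A) hN
  have hfun : (fun a => τ.toTangentModel (τ.normalizedSquare a)) =
      fun a => τ.toTangentModel ((τ.reCLM (a * star a))⁻¹ • (a * star a)) := by
    simp only [normalizedSquare_eq_reCLM]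
  rw [hfun]
  refine hP.congr_fderiv ?_
  refine ContinuousLinearMap.ext fun v => ?_
  have e := τ.toTangentModel_squareEquiv (τ.isSelfAdjoint_normalizedSquare g) h1 hpos.ne'
    (v * star (g : A))
  have hR : R v = v * star (g : A) := rfl
  rw [← hR] at e
  rw [ContinuousLinearMap.comp_apply, ContinuousLinearMap.comp_apply, ContinuousLinearEquiv.coe_coe,
    ContinuousLinearEquiv.trans_apply, e, hR]
  congr 1
  rw [normalizedSquare_eq_reCLM]
  have hs : τ.reCLM ((g : A) * star v) = τ.reCLM (v * star (g : A)) := by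
    rw [← reCLM_star, star_mul, star_star]
  simp [hs]
  match_scalars <;> field_simp
  ring

theorem IsFaithful.isHomogeneousBanachManifoldOrbit (hf : τ.IsFaithful) (ht : τ.IsTracial) :
    IsHomogeneousBanachManifoldOrbit A Aˣ τ := by
  have hval : ∀ g : Aˣ, (τ.toTangentModel (τ.normalizedSquare g) : A) = τ.normalizedSquare g - 1 :=
    fun g => τ.coe_toTangentModel_of_apply_eq_one (τ.isSelfAdjoint_normalizedSquare g)
      (ht.apply_normalizedSquare g)
  have hsa : ∀ g h : Aˣ, IsSelfAdjoint ((g : A) * τ.normalizedSquare h * star (g : A)) := fun g h =>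
    (τ.isSelfAdjoint_normalizedSquare h).conjugate (g : A)
  -- A point `y` of the model space stands for the density `1 + y`; `ψ` conjugates this density and
  -- renormalizes it.
  refine IsHomogeneousBanachManifoldOrbit.of_equivariant_submersion τ
    (fun a => τ.toTangentModel (τ.normalizedSquare a)) τ.toTangentModel τ.tangentModel.subtypeL
    (fun p => τ.toTangentModel ((τ.reCLM (p.1 * (1 + (p.2 : A)) * star p.1))⁻¹ •
      (p.1 * (1 + (p.2 : A)) * star p.1)))
    τ.toTangentModel_rightInverse ?_ ht.hasFDerivAt_normalizedSquare ?_ ?_ ?_ ?_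
  · intro g
    simp only [normalizedSquare_eq_reCLM]
    exact τ.toTangentModel.contDiff.contDiffAt.comp _
      (τ.contDiffAt_inv_reCLM_smul contDiff_mul_star.contDiffAt
        (ht.reCLM_mul_star_self_pos g).ne')
  · ext
    rw [normalizedSquare_one, coe_toTangentModel_of_apply_eq_one τ (.one A) τ.map_one]
    simp
  · intro g h
    rw [← hf.normalizedSquare_eq_iff ht, Subtype.ext_iff, hval, hval, sub_left_inj]
  · intro g h
    refine τ.toTangentModel.contDiff.contDiffAt.comp _ (τ.contDiffAt_inv_reCLM_smul ?_ ?_)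
    · refine ContDiff.contDiffAt ?_
      have h1 : ContDiff ℝ ∞ fun p : A × τ.tangentModel => p.1 := contDiff_fst
      have h2 : ContDiff ℝ ∞ fun p : A × τ.tangentModel => (p.2 : A) :=
        τ.tangentModel.subtypeL.contDiff.comp contDiff_snd
      exact (h1.mul (contDiff_const.add h2)).mul ((starL' ℝ : A ≃L[ℝ] A).contDiff.comp h1)
    · dsimp only
      rw [hval, add_sub_cancel]
      -- Were the denominator zero, its inverse would be `0` and so would the density of `(g * h) •
      -- τ`, whose trace is one.
      intro h0
      have h2 := ht.apply_normalizedSquare (g * h)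
      rw [ht.normalizedSquare_mul, ← coe_reCLM_of_isSelfAdjoint τ (hsa g h), h0] at h2
      simp at h2
  · intro g h
    dsimp only
    rw [ht.normalizedSquare_mul, hval, add_sub_cancel, ← coe_reCLM_of_isSelfAdjoint τ (hsa g h),
      ← Complex.ofReal_inv, Complex.coe_smul]

end CStarState

/-! ### Densities of the states on the orbit, and the finite-dimensional case. -/

namespace CStarState

variable {A : Type u} [CStarAlgebra A] {τ : CStarState A}

theorem mem_normalizedSquares_iff (τ : CStarState A) {x : A} :
    x ∈ τ.normalizedSquares ↔ ∃ g : Aˣ, x = τ.normalizedSquare g := Iff.rfl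

/-- A positive invertible element is the square of a self-adjoint unit. -/
theorem exists_units_mul_star_eq {x : A} (hx : ∃ b : A, x = b * star b) (hu : IsUnit x) :
    ∃ g : Aˣ, x = (g : A) * star (g : A) := by
  let _ := CStarAlgebra.spectralOrder A
  let _ := CStarAlgebra.spectralOrderedRing A
  obtain ⟨b, hb⟩ := hx
  have h0 : 0 ≤ x := hb ▸ mul_star_self_nonneg b
  have hs : CFC.sqrt x * CFC.sqrt x = x := CFC.sqrt_mul_sqrt_self x h0
  have hsa : IsSelfAdjoint (CFC.sqrt x) := IsSelfAdjoint.of_nonneg (CFC.sqrt_nonneg x)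
  have hsu : IsUnit (CFC.sqrt x) := by
    rw [← hs] at hu
    exact ((Commute.refl _).isUnit_mul_iff.1 hu).1
  refine ⟨hsu.unit, ?_⟩
  rw [IsUnit.unit_spec, hsa.star_eq, hs]

theorem IsTracial.normalizedSquares_eq (ht : τ.IsTracial) :
    τ.normalizedSquares = {x : A | (∃ b : A, x = b * star b) ∧ IsUnit x ∧ τ x = 1} := by
  ext x
  rw [mem_normalizedSquares_iff]
  constructor
  · rintro ⟨g, rfl⟩
    have hpos := ht.reCLM_mul_star_self_pos g
    refine ⟨⟨(√(τ.reCLM ((g : A) * star (g : A))))⁻¹ • (g : A), ?_⟩, ?_, ht.apply_normalizedSquare g⟩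
    · rw [normalizedSquare_eq_reCLM, star_smul, smul_mul_smul_comm,
        star_trivial (_ : ℝ), ← mul_inv,
        Real.mul_self_sqrt hpos.le]
    · rw [normalizedSquare]
      exact (isUnit_smul_iff (Units.mk0 _ (inv_ne_zero (ht.apply_mul_star_self_pos g).ne')) _).2
        (g * star g).isUnit
  · rintro ⟨hx, hu, h1⟩
    obtain ⟨g, hg⟩ := exists_units_mul_star_eq hx hu
    refine ⟨g, ?_⟩
    rw [normalizedSquare, ← hg, h1, inv_one, one_smul]

theorem IsFaithful.exists_orbit_equiv (hf : τ.IsFaithful) (ht : τ.IsTracial) :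
    ∃ e : MulAction.orbit Aˣ τ ≃ τ.normalizedSquares,
      (∀ g : Aˣ, (e ⟨g • τ, MulAction.mem_orbit τ g⟩ : A) = τ.normalizedSquare g) ∧
      ∀ (ρ : MulAction.orbit Aˣ τ) (a : A), ρ.1 a = τ ((e ρ : A) * a) := by
  have hex : ∀ ρ : MulAction.orbit Aˣ τ, ∃ g : Aˣ, g • τ = ρ := fun ρ => ρ.2
  choose k hk using hex
  let f : MulAction.orbit Aˣ τ → τ.normalizedSquares := fun ρ => ⟨τ.normalizedSquare (k ρ), k ρ, rfl⟩
  have hfg : ∀ g : Aˣ, (f ⟨g • τ, MulAction.mem_orbit τ g⟩ : A) = τ.normalizedSquare g := fun g =>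
    -- The chosen representative does not matter: units with the same image of `τ` have the same
    -- density.
    (hf.normalizedSquare_eq_iff ht _ _).2 (hk ⟨g • τ, MulAction.mem_orbit τ g⟩)
  have hbij : Function.Bijective f := by
    constructor
    · rintro ⟨_, g, rfl⟩ ⟨_, h, rfl⟩ hgh
      have h1 := congrArg Subtype.val hgh
      rw [hfg, hfg, hf.normalizedSquare_eq_iff ht] at h1
      exact Subtype.ext h1
    · rintro ⟨x, g, hx⟩
      exact ⟨⟨g • τ, MulAction.mem_orbit τ g⟩, Subtype.ext ((hfg g).trans hx.symm)⟩
  refine ⟨Equiv.ofBijective f hbij, hfg, ?_⟩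
  rintro ⟨_, g, rfl⟩ a
  rw [Equiv.ofBijective_apply, hfg]
  exact ht.smul_apply g a

theorem IsFaithful.smul (hf : τ.IsFaithful) (g : Aˣ) : (g • τ).IsFaithful := by
  intro a ha
  rw [CStarState.smul_apply]
  refine div_pos ?_ (τ.apply_star_mul_self_pos g)
  have h := hf (a * g) (by rwa [Ne, Units.mul_left_eq_zero])
  rwa [star_mul, mul_assoc, ← mul_assoc (star a), ← mul_assoc] at h

/-- A density with respect to a faithful tracial state that defines a faithful state is positive. -/
theorem IsTracial.exists_eq_mul_star_of_density (ht : τ.IsTracial) (hf : τ.IsFaithful)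
    {ρ : CStarState A} (hρ : ρ.IsFaithful) {x : A} (hx : ∀ a, ρ a = τ (x * a)) :
    ∃ b : A, x = b * star b := by
  let _ := CStarAlgebra.spectralOrder A
  let _ := CStarAlgebra.spectralOrderedRing A
  have hsa : IsSelfAdjoint x := hf.ext_mul fun a => by
    rw [ht a x, ← hx, ← star_star a, ← star_mul, map_star, map_star, hx]
  have hn0 : 0 ≤ x⁻ := CFC.negPart_nonneg x
  have hnsa : star x⁻ = x⁻ := (IsSelfAdjoint.of_nonneg hn0).star_eq
  have hxn : x * x⁻ = -(x⁻ * x⁻) := by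
    nth_rw 1 [← CFC.posPart_sub_negPart x hsa]
    rw [sub_mul, CFC.posPart_mul_negPart, zero_sub]
  obtain ⟨b, hb⟩ := CStarAlgebra.nonneg_iff_eq_star_mul_self.1 hn0
  -- Testing `ρ` on the square of `x⁻` gives `-τ ((x⁻)^3) ≤ 0`, which faithfulness of `ρ` forbids
  -- unless `x⁻ = 0`.
  have hn : x⁻ = 0 := by
    by_contra hne
    have h1 := hρ _ hne
    have h2 : x * (star x⁻ * x⁻) = -(star (b * x⁻) * (b * x⁻)) := by
      rw [hnsa, ← mul_assoc, hxn, star_mul, hnsa, mul_assoc, ← mul_assoc (star b), ← hb, neg_mul,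
        mul_assoc]
    rw [hx, h2, map_neg] at h1
    exact absurd (τ.nonneg (b * x⁻)) (not_le_of_gt (neg_pos.1 h1))
  have hx0 : 0 ≤ x := by
    rw [← CFC.posPart_sub_negPart x hsa, hn, sub_zero]
    exact CFC.posPart_nonneg x
  obtain ⟨c, hc⟩ := CStarAlgebra.nonneg_iff_eq_star_mul_self.1 hx0
  exact ⟨star c, by rw [star_star, hc]⟩

/-- By faithfulness `x ↦ τ (x ·)` is an injection of `A` into its dual, hence onto by equality of
dimensions. -/
theorem IsFaithful.exists_density [FiniteDimensional ℂ A] (hf : τ.IsFaithful) (ht : τ.IsTracial)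
    (ρ : CStarState A) : ∃ x : A, ∀ a, ρ a = τ (x * a) := by
  let T : A →ₗ[ℂ] Module.Dual ℂ A := (LinearMap.mul ℂ A).compr₂ (τ.toCLM : A →ₗ[ℂ] ℂ)
  have hT : ∀ x a, T x a = τ (x * a) := fun x a => rfl
  have hinj : Function.Injective T := by
    intro x y hxy
    refine hf.ext_mul fun a => ?_
    rw [ht a x, ht a y, ← hT, ← hT, hxy]
  obtain ⟨x, hx⟩ := (LinearMap.injective_iff_surjective_of_finrank_eq_finrank
    Subspace.dual_finrank_eq.symm).1 hinj (ρ.toCLM : A →ₗ[ℂ] ℂ)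
  exact ⟨x, fun a => by rw [← hT, hx]; rfl⟩

/-- If `x a = 0`, then `ρ (a a†) = τ (x a a†) = 0`, so `a = 0`. Left multiplication by `x` is thus
bijective, and the adjoint of a right inverse is a left inverse. -/
theorem IsFaithful.isUnit_density [FiniteDimensional ℂ A] {ρ : CStarState A} (hρ : ρ.IsFaithful)
    {x : A} (hsa : IsSelfAdjoint x) (hx : ∀ a, ρ a = τ (x * a)) : IsUnit x := by
  have hinj : Function.Injective (LinearMap.mulLeft ℂ x) := by
    rw [← LinearMap.ker_eq_bot, LinearMap.ker_eq_bot']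
    intro a ha
    by_contra hne
    have h1 := hρ (star a) (star_ne_zero.2 hne)
    have h2 : x * a = 0 := ha
    rw [hx, star_star, ← mul_assoc, h2, zero_mul, map_zero] at h1
    exact lt_irrefl _ h1
  obtain ⟨y, hy⟩ := LinearMap.surjective_of_injective hinj 1
  have hxy : x * y = 1 := hy
  have hyx : star y * x = 1 := by
    rw [← hsa.star_eq, ← star_mul, hxy, star_one]
  exact ⟨⟨x, y, hxy, by rwa [left_inv_eq_right_inv hyx hxy] at hyx⟩, rfl⟩

theorem IsFaithful.orbit_eq [FiniteDimensional ℂ A] (hf : τ.IsFaithful) (ht : τ.IsTracial) :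
    MulAction.orbit Aˣ τ = {ρ | ρ.IsFaithful} := by
  ext ρ
  constructor
  · rintro ⟨g, rfl⟩
    exact hf.smul g
  · intro hρ
    obtain ⟨x, hx⟩ := hf.exists_density ht ρ
    obtain ⟨b, hb⟩ := ht.exists_eq_mul_star_of_density hf hρ hx
    have hu := IsFaithful.isUnit_density hρ (hb ▸ IsSelfAdjoint.mul_star_self b) hx
    have h1 : τ x = 1 := by rw [← mul_one x, ← hx, ρ.map_one]
    have hmem : x ∈ τ.normalizedSquares := by
      rw [ht.normalizedSquares_eq]
      exact ⟨⟨b, hb⟩, hu, h1⟩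
    obtain ⟨g, hg⟩ := hmem
    refine ⟨g, ?_⟩
    ext a
    change (g • τ) a = ρ a
    rw [ht.smul_apply, hx a, hg]
    rfl

end CStarState

/-! ### The open simplex -/

section Simplex

variable {n : ℕ}

/-- The state of `ℂ^n` given by a probability vector. -/
noncomputable def CStarState.ofSimplex (p : Fin n → ℝ) (hp : ∀ i, 0 < p i) (h1 : ∑ i, p i = 1) :
    CStarState (Fin n → ℂ) where
  toCLM := ∑ i, (p i : ℂ) • ContinuousLinearMap.proj i
  nonneg a := by
    simp only [sum_apply, _root_.smul_apply,
      ContinuousLinearMap.proj_apply, Pi.mul_apply, Pi.star_apply, smul_eq_mul]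
    exact Finset.sum_nonneg fun i _ =>
      mul_nonneg (Complex.zero_le_real.2 (hp i).le) (star_mul_self_nonneg _)
  map_one := by
    simp only [sum_apply, _root_.smul_apply,
      ContinuousLinearMap.proj_apply, Pi.one_apply, smul_eq_mul, mul_one]
    exact_mod_cast h1

theorem CStarState.ofSimplex_apply (p : Fin n → ℝ) (hp : ∀ i, 0 < p i) (h1 : ∑ i, p i = 1)
    (a : Fin n → ℂ) : CStarState.ofSimplex p hp h1 a = ∑ i, (p i : ℂ) * a i := by
  simp [CStarState.ofSimplex]

theorem CStarState.isFaithful_ofSimplex (p : Fin n → ℝ) (hp : ∀ i, 0 < p i) (h1 : ∑ i, p i = 1) :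
    (CStarState.ofSimplex p hp h1).IsFaithful := by
  intro a ha
  rw [CStarState.ofSimplex_apply]
  obtain ⟨j, hj⟩ := Function.ne_iff.1 ha
  refine Finset.sum_pos' (fun i _ => mul_nonneg (Complex.zero_le_real.2 (hp i).le)
    (star_mul_self_nonneg _)) ⟨j, Finset.mem_univ j, mul_pos (Complex.zero_lt_real.2 (hp j)) ?_⟩
  have h2 : (star a * a) j = ((‖a j‖ ^ 2 : ℝ) : ℂ) := by
    rw [Pi.mul_apply, Pi.star_apply, Complex.star_def, Complex.conj_mul', Complex.ofReal_pow]
  rw [h2, Complex.zero_lt_real]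
  exact pow_pos (norm_pos_iff.2 hj) 2

theorem CStarState.IsFaithful.exists_simplex_equiv {τ : CStarState (Fin n → ℂ)}
    (hf : τ.IsFaithful) :
    ∃ e : {p : Fin n → ℝ // (∀ i, 0 < p i) ∧ ∑ i, p i = 1} ≃ MulAction.orbit (Fin n → ℂ)ˣ τ,
      ∀ p a, (e p).1 a = ∑ i, (p.1 i : ℂ) * a i := by
  have ht : τ.IsTracial := fun a b => by rw [mul_comm]
  have horb := hf.orbit_eq ht
  let f : {p : Fin n → ℝ // (∀ i, 0 < p i) ∧ ∑ i, p i = 1} → MulAction.orbit (Fin n → ℂ)ˣ τ :=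
    fun p => ⟨CStarState.ofSimplex p.1 p.2.1 p.2.2, by
      rw [horb]; exact CStarState.isFaithful_ofSimplex _ _ _⟩
  have hfa : ∀ p a, (f p).1 a = ∑ i, (p.1 i : ℂ) * a i := fun p a =>
    CStarState.ofSimplex_apply p.1 p.2.1 p.2.2 a
  refine ⟨Equiv.ofBijective f ⟨fun p q hpq => ?_, ?_⟩, hfa⟩
  · ext i
    have h := hfa p (Pi.single i 1)
    rw [hpq, hfa] at h
    simpa [Pi.single_apply] using h.symm
  · rintro ⟨ρ, hρ⟩
    have hρf : ρ.IsFaithful := by rw [horb] at hρ; exact hρ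
    -- The weights are the values of `ρ` on the basis idempotents, each of which equals its own `a†
    -- a`.
    have hpos : ∀ i : Fin n, 0 < ρ (Pi.single i 1) := fun i => by
      have h := hρf (Pi.single i 1) (by simp)
      rwa [← Pi.single_star, star_one, ← Pi.single_mul, mul_one] at h
    have hre : ∀ i : Fin n, ((ρ (Pi.single i 1)).re : ℂ) = ρ (Pi.single i 1) := fun i =>
      (Complex.eq_re_of_ofReal_le (r := 0) (by simpa using (hpos i).le)).symm
    have hsum : ∀ a : Fin n → ℂ, ρ a = ∑ i, ((ρ (Pi.single i 1)).re : ℂ) * a i := fun a => by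
      conv_lhs => rw [← Finset.univ_sum_single a]
      rw [map_sum]
      refine Finset.sum_congr rfl fun i _ => ?_
      have : (Pi.single i (a i) : Fin n → ℂ) = a i • Pi.single i 1 := by
        rw [← Pi.single_smul, smul_eq_mul, mul_one]
      rw [this, map_smul, smul_eq_mul, hre, mul_comm]
    refine ⟨⟨fun i => (ρ (Pi.single i 1)).re, fun i => (Complex.lt_def.1 (hpos i)).1, ?_⟩, ?_⟩
    · have h := hsum 1
      rw [ρ.map_one] at h
      simp only [Pi.one_apply, mul_one] at h
      exact_mod_cast h.symm
    · refine Subtype.ext (CStarState.ext (ContinuousLinearMap.ext fun a => ?_))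
      exact (hfa _ a).trans (hsum a).symm

end Simplex

namespace CStarState

/-- In the commutative case this becomes the formula for the action on probability densities. -/
theorem IsTracial.orbit_equiv_smul {A : Type u} [CStarAlgebra A] {τ : CStarState A}
    (ht : τ.IsTracial) (e : MulAction.orbit Aˣ τ ≃ τ.normalizedSquares)
    (he : ∀ g : Aˣ, (e ⟨g • τ, MulAction.mem_orbit τ g⟩ : A) = τ.normalizedSquare g)
    (g : Aˣ) (ρ : MulAction.orbit Aˣ τ) :
    (e (g • ρ) : A) = (τ ((g : A) * e ρ * star (g : A)))⁻¹ • ((g : A) * e ρ * star (g : A)) := by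
  obtain ⟨_, h, rfl⟩ := ρ
  have h1 : g • (⟨h • τ, MulAction.mem_orbit τ h⟩ : MulAction.orbit Aˣ τ) =
      ⟨(g * h) • τ, MulAction.mem_orbit τ (g * h)⟩ := Subtype.ext (mul_smul g h τ).symm
  refine (congrArg (fun σ => (e σ : A)) h1).trans ?_
  rw [he, ht.normalizedSquare_mul, ← he h]

end CStarState

/-! ### The orbit of the integral on `L^∞` -/

namespace LInfty

variable {X : Type v} [MeasurableSpace X] {ν : Measure X}

theorem exists_coeFn_ae_eq {f : X → ℂ} (hf : AEStronglyMeasurable f ν) {C : ℝ}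
    (hC : ∀ᵐ x ∂ν, ‖f x‖ ≤ C) : ∃ F : LInfty ν, ∀ᵐ x ∂ν, F x = f x :=
  ⟨(memLp_top_of_bound hf C hC).toLp f, MemLp.coeFn_toLp _⟩

theorem coeFn_star_mul_self (f : LInfty ν) :
    ∀ᵐ x ∂ν, (star f * f) x = ((‖f x‖ ^ 2 : ℝ) : ℂ) := by
  filter_upwards [coeFn_mul (star f) f, coeFn_star f] with x h1 h2
  rw [h1, h2, ← starRingEnd_apply, Complex.conj_mul', Complex.ofReal_pow]

theorem integral_star_mul_self (f : LInfty ν) :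
    ∫ x, (star f * f) x ∂ν = ((∫ x, ‖f x‖ ^ 2 ∂ν : ℝ) : ℂ) := by
  rw [integral_congr_ae (coeFn_star_mul_self f), integral_complex_ofReal]

section Orbit

variable [IsProbabilityMeasure ν]

theorem integralState_apply (f : LInfty ν) : integralState ν f = ∫ x, f x ∂ν := rfl

theorem integralState_mul (f h : LInfty ν) : integralState ν (f * h) = ∫ x, f x * h x ∂ν :=
  integral_congr_ae (coeFn_mul f h)

theorem isTracial_integralState : (integralState ν).IsTracial := fun a b => by rw [mul_comm]

theorem isFaithful_integralState : (integralState ν).IsFaithful := by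
  intro f hf
  rw [integralState_apply, integral_star_mul_self, Complex.zero_lt_real]
  have hint : Integrable (fun x => ‖f x‖ ^ 2) ν :=
    ((Lp.memLp f).mono_exponent le_top : MemLp f 2 ν).integrable_norm_pow (by simp)
  refine lt_of_le_of_ne (integral_nonneg fun x => by positivity) fun h0 => hf ?_
  have h1 := (integral_eq_zero_iff_of_nonneg (fun x => by positivity) hint).1 h0.symm
  apply Lp.ext
  filter_upwards [h1, coeFn_zero (ν := ν)] with x hx hx0
  rw [hx0]
  simpa using hx

theorem re_eq_of_ofReal_le {c : ℝ} {z : ℂ} (h : (c : ℂ) ≤ z) : ((z.re : ℝ) : ℂ) = z ∧ c ≤ z.re :=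
  ⟨(Complex.eq_re_of_ofReal_le h).symm, (Complex.le_def.1 h).1⟩

/-- If `y` inverts `f = |b|²`, then `1 = f |y| ≤ f ‖y‖` a.e., which bounds `f` below. Conversely, a
lower bound `c` makes `1 / f` bounded by `1 / c`, and `√f` is bounded by `√‖f‖`. -/
theorem normalizedSquares_integralState :
    (integralState ν).normalizedSquares = strictlyPositiveDensities ν := by
  rw [isTracial_integralState.normalizedSquares_eq]
  ext f
  constructor
  · rintro ⟨⟨b, rfl⟩, hu, h1⟩
    refine ⟨?_, h1⟩
    obtain ⟨y, hy⟩ := hu.exists_right_inv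
    have hpos : 0 < ‖y‖ + 1 := by positivity
    -- Adding `1` gives a positive constant without having to show `y ≠ 0`.
    refine ⟨(‖y‖ + 1)⁻¹, inv_pos.2 hpos, ?_⟩
    have hy' := coeFn_mul (b * star b) y
    rw [hy] at hy'
    rw [mul_comm b] at hy' ⊢
    filter_upwards [coeFn_star_mul_self b, hy', coeFn_one (ν := ν), ae_norm_le y]
      with x hb hxy hx1 hyn
    rw [hx1, hb] at hxy
    rw [hb]
    refine Complex.real_le_real.2 ?_
    have h2 := congrArg norm hxy
    rw [norm_one, norm_mul, Complex.norm_real, Real.norm_of_nonneg (by positivity)] at h2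
    rw [inv_le_iff_one_le_mul₀ hpos, h2]
    gcongr
    linarith
  · rintro ⟨⟨c, hc, hcf⟩, h1⟩
    have hmeas : AEStronglyMeasurable f ν := Lp.aestronglyMeasurable f
    have hre : AEMeasurable (fun x => (f x).re) ν :=
      Complex.measurable_re.comp_aemeasurable hmeas.aemeasurable
    obtain ⟨b, hb⟩ := exists_coeFn_ae_eq (ν := ν) (f := fun x => ((√(f x).re : ℝ) : ℂ))
      (C := √‖f‖)
      (Complex.measurable_ofReal.comp_aemeasurable
        (Real.continuous_sqrt.measurable.comp_aemeasurable hre)).aestronglyMeasurable (by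
        filter_upwards [ae_norm_le f] with x hx
        rw [Complex.norm_real, Real.norm_of_nonneg (Real.sqrt_nonneg _)]
        exact Real.sqrt_le_sqrt ((Complex.re_le_norm _).trans hx))
    obtain ⟨y, hy⟩ := exists_coeFn_ae_eq (ν := ν) (f := fun x => (f x)⁻¹) (C := c⁻¹)
      hmeas.aemeasurable.inv.aestronglyMeasurable (by
        filter_upwards [hcf] with x hx
        rw [norm_inv]
        exact inv_anti₀ hc ((re_eq_of_ofReal_le hx).2.trans (Complex.re_le_norm _)))
    refine ⟨⟨b, ?_⟩, ?_, h1⟩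
    · apply Lp.ext
      filter_upwards [hb, hcf, coeFn_mul b (star b), coeFn_star b] with x hx hxc hm hs
      obtain ⟨h2, h3⟩ := re_eq_of_ofReal_le hxc
      rw [hm, hs, hx, Complex.star_def, Complex.conj_ofReal, ← Complex.ofReal_mul,
        Real.mul_self_sqrt (hc.le.trans h3), h2]
    · refine IsUnit.of_mul_eq_one y ?_
      apply Lp.ext
      filter_upwards [hy, hcf, coeFn_mul f y, coeFn_one (ν := ν)] with x hx hxc hm h1
      obtain ⟨h2, h3⟩ := re_eq_of_ofReal_le hxc
      have hne : f x ≠ 0 := by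
        rw [← h2]
        exact_mod_cast (hc.trans_le h3).ne'
      rw [hm, hx, h1, mul_inv_cancel₀ hne]

theorem exists_densities_equiv_orbit :
    ∃ e : strictlyPositiveDensities ν ≃ MulAction.orbit (LInfty ν)ˣ (integralState ν),
      (∀ f h, (e f).1 h = ∫ x, f.1 x * h x ∂ν) ∧
      ∀ (g : (LInfty ν)ˣ) f, ∀ᵐ x ∂ν, (e.symm (g • e f)).1 x =
        (‖(g : LInfty ν) x‖ ^ 2 : ℝ) * f.1 x /
          ∫ y, (‖(g : LInfty ν) y‖ ^ 2 : ℝ) * f.1 y ∂ν := by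
  obtain ⟨e₀, he, hea⟩ :=
    (isFaithful_integralState (ν := ν)).exists_orbit_equiv isTracial_integralState
  refine ⟨(Equiv.setCongr normalizedSquares_integralState.symm).trans e₀.symm, ?_, ?_⟩
  · intro f h
    rw [hea, Equiv.trans_apply, Equiv.apply_symm_apply]
    exact integralState_mul _ _
  · intro g f
    let f₀ : (integralState ν).normalizedSquares :=
      Equiv.setCongr normalizedSquares_integralState.symm f
    have h1 : (g : LInfty ν) * f.1 * star (g : LInfty ν) =
        (star (g : LInfty ν) * (g : LInfty ν)) * f.1 := by ring
    have h2 : ∀ᵐ x ∂ν, ((star (g : LInfty ν) * (g : LInfty ν)) * f.1) x =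
        (‖(g : LInfty ν) x‖ ^ 2 : ℝ) * f.1 x := by
      filter_upwards [coeFn_mul (star (g : LInfty ν) * (g : LInfty ν)) f.1,
        coeFn_star_mul_self (g : LInfty ν)] with x hx hx'
      rw [hx, hx']
    have h3 := isTracial_integralState.orbit_equiv_smul e₀ he g (e₀.symm f₀)
    rw [Equiv.apply_symm_apply] at h3
    have h4 : (e₀ (g • e₀.symm f₀) : LInfty ν) =
        (∫ y, (‖(g : LInfty ν) y‖ ^ 2 : ℝ) * f.1 y ∂ν)⁻¹ •
          ((star (g : LInfty ν) * (g : LInfty ν)) * f.1) := by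
      rw [h3]
      change (integralState ν ((g : LInfty ν) * f.1 * star (g : LInfty ν)))⁻¹ •
        ((g : LInfty ν) * f.1 * star (g : LInfty ν)) = _
      rw [h1, integralState_apply, integral_congr_ae h2]
    change ∀ᵐ x ∂ν, (e₀ (g • e₀.symm f₀) : LInfty ν) x = _
    rw [h4]
    filter_upwards [h2, coeFn_smul (∫ y, (‖(g : LInfty ν) y‖ ^ 2 : ℝ) * f.1 y ∂ν)⁻¹
      ((star (g : LInfty ν) * (g : LInfty ν)) * f.1)] with x hx hx'
    rw [hx', hx, div_eq_inv_mul]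

theorem mem_orbit_iff_exists_density (ρ : CStarState (LInfty ν)) :
    ρ ∈ MulAction.orbit (LInfty ν)ˣ (integralState ν) ↔
      ∃ f ∈ strictlyPositiveDensities ν, ∀ h : LInfty ν, ρ h = ∫ x, f x * h x ∂ν := by
  obtain ⟨e, he, -⟩ := exists_densities_equiv_orbit (ν := ν)
  constructor
  · intro hρ
    refine ⟨_, (e.symm ⟨ρ, hρ⟩).2, fun h => ?_⟩
    rw [← he, Equiv.apply_symm_apply]
  · rintro ⟨f, hf, hfρ⟩
    have : ρ = (e ⟨f, hf⟩).1 :=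
      CStarState.ext (ContinuousLinearMap.ext fun h => (hfρ h).trans (he ⟨f, hf⟩ h).symm)
    rw [this]
    exact (e ⟨f, hf⟩).2

theorem mem_orbit_iff_exists_measure (ρ : CStarState (LInfty ν)) :
    ρ ∈ MulAction.orbit (LInfty ν)ˣ (integralState ν) ↔
      ∃ μ : Measure X, IsProbabilityMeasure μ ∧ μ ≪ ν ∧ ν ≪ μ ∧
        (∃ c C : ℝ, 0 < c ∧ ∀ᵐ x ∂ν,
          ENNReal.ofReal c ≤ μ.rnDeriv ν x ∧ μ.rnDeriv ν x ≤ ENNReal.ofReal C) ∧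
        ∀ h : LInfty ν, ρ h = ∫ x, h x ∂μ := by
  rw [mem_orbit_iff_exists_density]
  constructor
  · rintro ⟨f, ⟨⟨c, hc, hcf⟩, h1⟩, hρ⟩
    have hre : AEMeasurable (fun x => (f x).re) ν :=
      Complex.measurable_re.comp_aemeasurable (Lp.aestronglyMeasurable f).aemeasurable
    have hd : AEMeasurable (fun x => ENNReal.ofReal (f x).re) ν := hre.ennreal_ofReal
    have hnn : 0 ≤ᵐ[ν] fun x => (f x).re := by
      filter_upwards [hcf] with x hx
      exact hc.le.trans (re_eq_of_ofReal_le hx).2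
    have hint : Integrable (fun x => (f x).re) ν := (integrable f).re
    -- The measure is `f ν`. Positivity of `f` gives absolute continuity in both directions, and
    -- `‖f‖` is the upper bound.
    refine ⟨ν.withDensity fun x => ENNReal.ofReal (f x).re, ⟨?_⟩,
      withDensity_absolutelyContinuous _ _, withDensity_absolutelyContinuous' hd ?_,
      ⟨c, ‖f‖, hc, ?_⟩, fun h => ?_⟩
    · rw [withDensity_apply _ MeasurableSet.univ, Measure.restrict_univ,
        ← ofReal_integral_eq_lintegral_ofReal hint hnn]
      have h2 : ∫ x, (f x).re ∂ν = 1 := by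
        have := integral_re (integrable f)
        rw [h1] at this
        simpa using this
      rw [h2, ENNReal.ofReal_one]
    · filter_upwards [hcf] with x hx
      exact (ENNReal.ofReal_pos.2 (hc.trans_le (re_eq_of_ofReal_le hx).2)).ne'
    · filter_upwards [hcf, ae_norm_le f, Measure.rnDeriv_withDensity₀ ν hd] with x hx hn hr
      rw [hr]
      exact ⟨ENNReal.ofReal_le_ofReal (re_eq_of_ofReal_le hx).2,
        ENNReal.ofReal_le_ofReal ((Complex.re_le_norm _).trans hn)⟩
    · rw [hρ, integral_withDensity_eq_integral_toReal_smul₀ hd (by simp)]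
      refine integral_congr_ae ?_
      filter_upwards [hcf, hnn] with x hx hx0
      rw [ENNReal.toReal_ofReal hx0, Complex.real_smul, (re_eq_of_ofReal_le hx).1]
  · rintro ⟨μ, hμ, hμν, -, ⟨c, C, hc, hcC⟩, hρ⟩
    obtain ⟨f, hf⟩ := exists_coeFn_ae_eq (ν := ν) (f := fun x => ((μ.rnDeriv ν x).toReal : ℂ))
      -- The sign of `C` is not prescribed, and `(ENNReal.ofReal C).toReal` is `max C 0`.
      (C := max C 0)
      (Complex.measurable_ofReal.comp
        (Measure.measurable_rnDeriv μ ν).ennreal_toReal).aestronglyMeasurable (by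
        filter_upwards [hcC] with x hx
        rw [Complex.norm_real, Real.norm_of_nonneg ENNReal.toReal_nonneg,
          ← ENNReal.toReal_ofReal']
        exact ENNReal.toReal_mono ENNReal.ofReal_ne_top hx.2)
    refine ⟨f, ⟨⟨c, hc, ?_⟩, ?_⟩, fun h => ?_⟩
    · filter_upwards [hf, hcC] with x hx hxc
      rw [hx]
      exact Complex.real_le_real.2 ((ENNReal.ofReal_le_iff_le_toReal
        (ne_top_of_le_ne_top ENNReal.ofReal_ne_top hxc.2)).1 hxc.1)
    · rw [integral_congr_ae hf, integral_complex_ofReal, Measure.integral_toReal_rnDeriv hμν]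
      simp
    · rw [hρ, ← integral_rnDeriv_smul hμν]
      refine integral_congr_ae ?_
      filter_upwards [hf] with x hx
      rw [hx, Complex.real_smul]

end Orbit

end LInfty

theorem mainTheorem3 :
    -- the general result
    (∀ (A : Type u) [CStarAlgebra A] (τ : CStarState A), τ.IsFaithful → τ.IsTracial →
      IsHomogeneousBanachManifoldOrbit A Aˣ τ ∧
      τ.normalizedSquares = {x : A | (∃ b : A, x = b * star b) ∧ IsUnit x ∧ τ x = 1} ∧
      (∃ e : MulAction.orbit Aˣ τ ≃ τ.normalizedSquares,
        (∀ g : Aˣ, (e ⟨g • τ, MulAction.mem_orbit τ g⟩ : A) =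
          (τ ((g : A) * star (g : A)))⁻¹ • ((g : A) * star (g : A))) ∧
        ∀ (ρ : MulAction.orbit Aˣ τ) (a : A), ρ.1 a = τ ((e ρ : A) * a)) ∧
      (FiniteDimensional ℂ A → MulAction.orbit Aˣ τ = {ρ | ρ.IsFaithful})) ∧
    -- the case of `ℂ^n`
    (∀ (n : ℕ) (τ : CStarState (Fin n → ℂ)), τ.IsFaithful →
      ∃ e : {p : Fin n → ℝ // (∀ i, 0 < p i) ∧ ∑ i, p i = 1} ≃ MulAction.orbit (Fin n → ℂ)ˣ τ,
        ∀ p a, (e p).1 a = ∑ i, (p.1 i : ℂ) * a i) ∧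
    -- the case of `L^∞(X, ν)`
    (∀ (X : Type v) [MeasurableSpace X] (ν : Measure X) [IsProbabilityMeasure ν],
      (LInfty.integralState ν).IsFaithful ∧ (LInfty.integralState ν).IsTracial ∧
      IsHomogeneousBanachManifoldOrbit (LInfty ν) (LInfty ν)ˣ (LInfty.integralState ν) ∧
      (∃ e : LInfty.strictlyPositiveDensities ν ≃
          MulAction.orbit (LInfty ν)ˣ (LInfty.integralState ν),
        (∀ f h, (e f).1 h = ∫ x, f.1 x * h x ∂ν) ∧
        ∀ (g : (LInfty ν)ˣ) f, ∀ᵐ x ∂ν, (e.symm (g • e f)).1 x =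
          (‖(g : LInfty ν) x‖ ^ 2 : ℝ) * f.1 x /
            ∫ y, (‖(g : LInfty ν) y‖ ^ 2 : ℝ) * f.1 y ∂ν) ∧
      ∀ ρ : CStarState (LInfty ν),
        ρ ∈ MulAction.orbit (LInfty ν)ˣ (LInfty.integralState ν) ↔
          ∃ μ : Measure X, IsProbabilityMeasure μ ∧ μ ≪ ν ∧ ν ≪ μ ∧
            (∃ c C : ℝ, 0 < c ∧ ∀ᵐ x ∂ν,
              ENNReal.ofReal c ≤ μ.rnDeriv ν x ∧ μ.rnDeriv ν x ≤ ENNReal.ofReal C) ∧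
            ∀ h : LInfty ν, ρ h = ∫ x, h x ∂μ) := by
  refine ⟨fun A _ τ hf ht => ⟨hf.isHomogeneousBanachManifoldOrbit ht, ht.normalizedSquares_eq,
    hf.exists_orbit_equiv ht, fun _ => hf.orbit_eq ht⟩, fun n τ hf => hf.exists_simplex_equiv, ?_⟩
  intro X _ ν _
  exact ⟨LInfty.isFaithful_integralState, LInfty.isTracial_integralState,
    LInfty.isFaithful_integralState.isHomogeneousBanachManifoldOrbit LInfty.isTracial_integralState,
    LInfty.exists_densities_equiv_orbit, LInfty.mem_orbit_iff_exists_measure⟩
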